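/- **Theorem.** Work in the ring $\mathbb{Z}[[q]]$ of formal power series, with coefficientwise convergence. For formal power series $a,b$ with zero constant coefficient put $(a;b)_n=\prod_{t=0}^{n-1}(1-ab^t)$ for $n\ge 0$, $(a;b)_\infty=\prod_{t\ge 0}(1-ab^t)$, and $(a_1,\dots,a_m;b)_\infty=(a_1;b)_\infty\cdots(a_m;b)_\infty$. Then all the sums below converge, and the following identities hold: $$\sum_{i,j\ge 0}\frac{q^{2i^2+6ij+6j^2}}{(q;q)_i\,(q^3;q^3)_j}=\frac{1}{(q^2,q^3,q^9,q^{10};q^{12})_\infty},$$ and $$\sum_{i,j,k,l\ge 0}\frac{q^{\frac{3(i+j+k+2l)(i+j+k+2l-1)}{2}+3i+5j+\frac{3j(j-1)}{2}+k+\frac{3k(k-1)}{2}+3l}}{(q^3;q^3)_i\,(q^3;q^3)_j\,(q^3;q^3)_k\,(q^6;q^6)_l} =\sum_{i,j\ge 0}\frac{q^{2i^2+6ij+6j^2+i}}{(q;q)_i\,(q^3;q^3)_j}+\sum_{i,j\ge 0}\frac{q^{2i^2+6ij+6j^2+4i+6j+1}}{(q;q)_i\,(q^3;q^3)_j} =(-q,-q^3,-q^5,-q^6;q^6)_\infty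 .$$ -/

import Mathlib

open PowerSeries

open scoped PowerSeries.WithPiTopology

/-! Formal power series in `q = X` over `ℤ`. Since `ℤ` is discrete, the product topology on `ℤ⟦X⟧` is
the usual topology of formal power series: each coefficient is eventually constant. -/

/-- The finite `q`-Pochhammer symbol `(a; q)_n = (1 - a)(1 - a q) ⋯ (1 - a q ^ (n - 1))`. -/
noncomputable def qPoch (a q : ℤ⟦X⟧) (n : ℕ) : ℤ⟦X⟧ :=
  ∏ t ∈ Finset.range n, (1 - a * q ^ t)

/-- The infinite `q`-Pochhammer symbol `(a; q)_∞ = ∏_{t ≥ 0} (1 - a q ^ t)`. The product converges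
as soon as `q` has zero constant coefficient, see `multipliable_qPochInf`. -/
noncomputable def qPochInf (a q : ℤ⟦X⟧) : ℤ⟦X⟧ :=
  ∏' t : ℕ, (1 - a * q ^ t)

/-- `(a₁, …, aₘ; q)_∞ = (a₁; q)_∞ ⋯ (aₘ; q)_∞`. -/
noncomputable def qPochInfList (as : List ℤ⟦X⟧) (q : ℤ⟦X⟧) : ℤ⟦X⟧ :=
  (as.map fun a => qPochInf a q).prod

/-- The quotient `f / g` of formal power series, for `g` invertible in `ℤ⟦X⟧`. All denominators
used below are invertible, see `isUnit_qPoch` and `isUnit_qPochInfList`. -/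
noncomputable def psDiv (f g : ℤ⟦X⟧) : ℤ⟦X⟧ :=
  f * Ring.inverse g

theorem multipliable_qPochInf (a q : ℤ⟦X⟧) (hq : constantCoeff q = 0) :
    Multipliable fun t : ℕ => 1 - a * q ^ t := by
  simp_rw [sub_eq_add_neg]
  apply PowerSeries.WithPiTopology.multipliable_one_add_of_tendsto_order_atTop_nhds_top
  refine ENat.tendsto_nhds_top_iff_natCast_lt.mpr
    (fun n => Filter.eventually_atTop.mpr ⟨n + 1, fun m hm => ?_⟩)
  have h1 : (X : ℤ⟦X⟧) ^ m ∣ -(a * q ^ m) :=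
    (dvd_neg).mpr (Dvd.dvd.mul_left (pow_dvd_pow_of_dvd (X_dvd_iff.mpr hq) m) a)
  have h2 := X_pow_dvd_iff.mp h1
  have h3 : (m : ℕ∞) ≤ (-(a * q ^ m)).order := nat_le_order _ _ h2
  exact lt_of_lt_of_le (by exact_mod_cast hm) h3

theorem isUnit_qPoch (a q : ℤ⟦X⟧) (ha : constantCoeff a = 0) (n : ℕ) : IsUnit (qPoch a q n) := by
  rw [isUnit_iff_constantCoeff, qPoch, map_prod]
  simp [ha]

theorem isUnit_qPochInf (a q : ℤ⟦X⟧) (ha : constantCoeff a = 0) (hq : constantCoeff q = 0) :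
    IsUnit (qPochInf a q) := by
  rw [isUnit_iff_constantCoeff, qPochInf, (multipliable_qPochInf a q hq).map_tprod _
    (PowerSeries.WithPiTopology.continuous_constantCoeff ℤ)]
  simp [ha]

theorem isUnit_qPochInfList (as : List ℤ⟦X⟧) (q : ℤ⟦X⟧) (ha : ∀ a ∈ as, constantCoeff a = 0)
    (hq : constantCoeff q = 0) : IsUnit (qPochInfList as q) := by
  induction as with
  | nil => simp [qPochInfList]
  | cons a as ih =>
    have h : qPochInfList (a :: as) q = qPochInf a q * qPochInfList as q := by
      simp [qPochInfList]
    rw [h]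
    exact (isUnit_qPochInf a q (ha a (by simp)) hq).mul
      (ih fun b hb => ha b (List.mem_cons_of_mem a hb))

/-- The summand `q ^ (2 i² + 6 i j + 6 j²) / ((q; q)_i (q³; q³)_j)`, for `p = (i, j)`. -/
noncomputable def cap1Term (p : ℕ × ℕ) : ℤ⟦X⟧ :=
  psDiv (X ^ (2 * p.1 ^ 2 + 6 * p.1 * p.2 + 6 * p.2 ^ 2))
    (qPoch X X p.1 * qPoch (X ^ 3) (X ^ 3) p.2)

/-- The summand `q ^ (2 i² + 6 i j + 6 j² + i) / ((q; q)_i (q³; q³)_j)`, for `p = (i, j)`. -/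
noncomputable def cap2TermA (p : ℕ × ℕ) : ℤ⟦X⟧ :=
  psDiv (X ^ (2 * p.1 ^ 2 + 6 * p.1 * p.2 + 6 * p.2 ^ 2 + p.1))
    (qPoch X X p.1 * qPoch (X ^ 3) (X ^ 3) p.2)

/-- The summand `q ^ (2 i² + 6 i j + 6 j² + 4 i + 6 j + 1) / ((q; q)_i (q³; q³)_j)`,
for `p = (i, j)`. -/
noncomputable def cap2TermB (p : ℕ × ℕ) : ℤ⟦X⟧ :=
  psDiv (X ^ (2 * p.1 ^ 2 + 6 * p.1 * p.2 + 6 * p.2 ^ 2 + 4 * p.1 + 6 * p.2 + 1))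
    (qPoch X X p.1 * qPoch (X ^ 3) (X ^ 3) p.2)

/-- The exponent `3 m (m - 1) / 2 + 3 i + 5 j + 3 j (j - 1) / 2 + k + 3 k (k - 1) / 2 + 3 l` with
`m = i + j + k + 2 l`. All divisions are exact, and the truncated differences are harmless since
`n * (n - 1) = 0` for `n = 0`. -/
def cap2Exponent (i j k l : ℕ) : ℕ :=
  3 * (i + j + k + 2 * l) * (i + j + k + 2 * l - 1) / 2 + 3 * i + 5 * j + 3 * j * (j - 1) / 2
    + k + 3 * k * (k - 1) / 2 + 3 * l

/-- The summand of the fourfold sum, for `p = (i, j, k, l)`. -/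
noncomputable def cap2TermFour (p : ℕ × ℕ × ℕ × ℕ) : ℤ⟦X⟧ :=
  psDiv (X ^ cap2Exponent p.1 p.2.1 p.2.2.1 p.2.2.2)
    (qPoch (X ^ 3) (X ^ 3) p.1 * qPoch (X ^ 3) (X ^ 3) p.2.1 *
      qPoch (X ^ 3) (X ^ 3) p.2.2.1 * qPoch (X ^ 6) (X ^ 6) p.2.2.2)

/-! ### Summation in rings of formal power series -/

/-! Put b = q³ and let L be the continuous additive functional z^n ↦ b^(n choose 2) on power series
in z over ℤ⟦q⟧ (`weightedSum`). Every sum of the theorem is L of a product of Euler-type series.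
With D(c) = (-cz; q)_∞ / (q³z²; q³)_∞ (`doubleSeries`), the first double sum is L(D(q²)), and the
other two are L(D(q³)) and L(qz D(q³)). Splitting (-cz; q)_∞ modulo 3 and cancelling (-q³z; q³)_∞
against the denominator turns D(q²) and (1 + qz) D(q³) into the common shape (-αz, -βz; b)_∞ / ((bz;
b)_∞ (bz²; b²)_∞), where αβ = b² (`doubleSeries_X_sq`, `one_add_mul_doubleSeries_X_cube`). For {α,
β} = {q, q⁵} the expansion of this shape is the fourfold sum. L of that shape is a product
(`weightedSum_geomSeries_mul_tripleSeries`). Euler's expansion sums out 1/(bz; b)_∞, leaving (-b;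
b)_∞ and a weight 1/(-b; b)_n. The finite summation `sum_gaussTerm` then produces exactly the factor
(-b; b)_n that cancels this weight, and the remaining double sum splits into two Euler sums in base
b². -/

theorem hasSum_monomial_mul {A : Type*} [Semiring A] [TopologicalSpace A] {d : ℕ} (hd : d ≠ 0)
    (v : ℕ → A) {F : A⟦X⟧} (h₁ : ∀ n, coeff (d * n) F = v n) (h₂ : ∀ n, ¬ d ∣ n → coeff n F = 0) :
    HasSum (fun j => monomial (d * j) (v j)) F := by
  rw [WithPiTopology.hasSum_iff_hasSum_coeff]
  intro n
  by_cases hn : d ∣ n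
  · obtain ⟨m, rfl⟩ := hn
    rw [h₁]
    convert hasSum_single m (fun j hj => ?_) using 1
    · rw [coeff_monomial_same]
    · rw [coeff_monomial, if_neg]
      exact fun h => hj (Nat.eq_of_mul_eq_mul_left (Nat.pos_of_ne_zero hd) h).symm
  · rw [h₂ n hn]
    convert hasSum_zero using 2 with j
    rw [coeff_monomial, if_neg]
    rintro rfl
    exact hn (Dvd.intro j rfl)

theorem summable_of_finite_coeff_ne_zero {A ι : Type*} [Semiring A] [TopologicalSpace A]
    {f : ι → A⟦X⟧} (h : ∀ d, {p | coeff d (f p) ≠ 0}.Finite) : Summable f := by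
  rw [WithPiTopology.summable_iff_summable_coeff]
  exact fun d => summable_of_hasFiniteSupport (h d)

theorem summable_of_X_pow_dvd {ι : Type*} {f : ι → ℤ⟦X⟧} (e : ι → ℕ)
    (he : ∀ d, {p | e p ≤ d}.Finite) (h : ∀ p, X ^ e p ∣ f p) : Summable f :=
  summable_of_finite_coeff_ne_zero fun d => (he d).subset fun p hp => by
    by_contra hlt
    exact hp (X_pow_dvd_iff.mp (h p) d (not_le.mp hlt))

theorem X_pow_dvd_of_hasSum {ι : Type*} {f : ι → ℤ⟦X⟧} {s : ℤ⟦X⟧} (hs : HasSum f s) {n : ℕ}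
    (h : ∀ p, X ^ n ∣ f p) : X ^ n ∣ s := by
  rw [X_pow_dvd_iff]
  intro m hm
  refine ((WithPiTopology.hasSum_iff_hasSum_coeff ℤ).mp hs m).unique ?_
  convert hasSum_zero using 2 with p
  exact X_pow_dvd_iff.mp (h p) m hm

theorem tendsto_of_X_pow_dvd_sub {f : ℕ → ℤ⟦X⟧} {a : ℤ⟦X⟧} (h : ∀ n, X ^ n ∣ f n - a) :
    Filter.Tendsto f Filter.atTop (nhds a) := by
  rw [WithPiTopology.tendsto_iff_coeff_tendsto]
  refine fun d => tendsto_nhds_of_eventually_eq (Filter.eventually_atTop.mpr ⟨d + 1, fun n hn => ?_⟩)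
  exact sub_eq_zero.mp ((map_sub _ _ _).symm.trans (X_pow_dvd_iff.mp (h n) d hn))

/-- The functional `F ↦ ∑ n, g n * coeff n F`, where `X ^ n ∣ g (n + 1)` for all `n`. -/
noncomputable def weightedSum (g : ℕ → ℤ⟦X⟧) : ℤ⟦X⟧⟦X⟧ →+ ℤ⟦X⟧ where
  -- Terms with n ≥ d + 2 cannot reach degree d, since then X ^ (d + 1) divides g n. The shift by
  -- one in the divisibility is forced by the intended weight b ^ (n choose 2), which equals 1 at n
  -- = 1.
  toFun F := PowerSeries.mk fun d => ∑ n ∈ Finset.range (d + 2), coeff d (g n * coeff n F)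
  map_zero' := by ext; simp
  map_add' F G := by ext; simp [mul_add, Finset.sum_add_distrib]

theorem continuous_weightedSum (g : ℕ → ℤ⟦X⟧) : Continuous (weightedSum g) := by
  refine continuous_iff_continuousAt.mpr fun F => ?_
  rw [ContinuousAt, WithPiTopology.tendsto_iff_coeff_tendsto]
  intro d
  simp only [weightedSum, AddMonoidHom.coe_mk, ZeroHom.coe_mk, coeff_mk]
  refine tendsto_finsetSum _ fun n _ => ?_
  exact ((WithPiTopology.continuous_coeff ℤ d).comp
    (continuous_const.mul (WithPiTopology.continuous_coeff ℤ⟦X⟧ n))).continuousAt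

theorem weightedSum_monomial {g : ℕ → ℤ⟦X⟧} (hg : ∀ n, X ^ n ∣ g (n + 1)) (n : ℕ) (r : ℤ⟦X⟧) :
    weightedSum g (monomial n r) = g n * r := by
  ext d
  simp only [weightedSum, AddMonoidHom.coe_mk, ZeroHom.coe_mk, coeff_mk, coeff_monomial]
  by_cases hn : n < d + 2
  · rw [Finset.sum_eq_single n]
    · simp
    · intro m _ hm
      simp [hm]
    · simp [hn]
  · rw [Finset.sum_eq_zero]
    · obtain ⟨m, rfl⟩ : ∃ m, n = m + 1 := ⟨n - 1, by omega⟩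
      exact (X_pow_dvd_iff.mp (Dvd.dvd.mul_right (hg m) r) d (by omega)).symm
    · intro m hm
      have : m ≠ n := by have := Finset.mem_range.mp hm; omega
      simp [this]

theorem hasSum_weightedSum {g : ℕ → ℤ⟦X⟧} (hg : ∀ n, X ^ n ∣ g (n + 1)) {ι : Type*} {w : ι → ℕ}
    {c : ι → ℤ⟦X⟧} {F : ℤ⟦X⟧⟦X⟧} (h : HasSum (fun p => monomial (w p) (c p)) F) :
    HasSum (fun p => g (w p) * c p) (weightedSum g F) := by
  convert h.map (weightedSum g) (continuous_weightedSum g) using 2 with p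
  simp [weightedSum_monomial hg]

/-- Summability of the product family is not automatic; it follows because finitely many index pairs
contribute to each degree in the outer variable. -/
theorem hasSum_monomial_mul_monomial {A : Type*} [CommRing A] [TopologicalSpace A] [IsTopologicalRing A]
    [T3Space A] {ι κ : Type*} {w : ι → ℕ} {w' : κ → ℕ} {c : ι → A} {c' : κ → A}
    {F G : A⟦X⟧} (hF : HasSum (fun p => monomial (w p) (c p)) F)
    (hG : HasSum (fun p => monomial (w' p) (c' p)) G)
    (hw : ∀ d, {p | w p ≤ d}.Finite) (hw' : ∀ d, {p | w' p ≤ d}.Finite) :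
    HasSum (fun p : ι × κ => monomial (w p.1 + w' p.2) (c p.1 * c' p.2)) (F * G) := by
  have hs : Summable fun p : ι × κ => monomial (w p.1) (c p.1) * monomial (w' p.2) (c' p.2) := by
    refine summable_of_finite_coeff_ne_zero fun d => ((hw d).prod (hw' d)).subset fun p hp => ?_
    rw [Set.mem_ofPred_eq, monomial_mul_monomial, coeff_monomial] at hp
    have : d = w p.1 + w' p.2 := by
      by_contra h
      simp [h] at hp
    simp only [Set.mem_prod, Set.mem_ofPred_eq]
    omega
  simpa only [monomial_mul_monomial] using hF.mul hG hs

/-! ### Pochhammer symbols -/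

/-- The inverse `1 / (b; b)_n`. -/
noncomputable def qFactInv (b : ℤ⟦X⟧) (n : ℕ) : ℤ⟦X⟧ :=
  Ring.inverse (qPoch b b n)

theorem qPoch_succ (a q : ℤ⟦X⟧) (n : ℕ) : qPoch a q (n + 1) = qPoch a q n * (1 - a * q ^ n) :=
  Finset.prod_range_succ _ _

theorem qPoch_mul_qFactInv {b : ℤ⟦X⟧} (hb : constantCoeff b = 0) (n : ℕ) :
    qPoch b b n * qFactInv b n = 1 :=
  Ring.mul_inverse_cancel _ (isUnit_qPoch b b hb n)

@[simp]
theorem qFactInv_zero (b : ℤ⟦X⟧) : qFactInv b 0 = 1 := by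
  simp [qFactInv, qPoch]

theorem one_sub_mul_qFactInv_succ {b : ℤ⟦X⟧} (hb : constantCoeff b = 0) (n : ℕ) :
    (1 - b ^ (n + 1)) * qFactInv b (n + 1) = qFactInv b n := by
  have h₁ := qPoch_mul_qFactInv hb (n + 1)
  rw [qPoch_succ] at h₁
  linear_combination qFactInv b n * h₁
    - (1 - b ^ (n + 1)) * qFactInv b (n + 1) * qPoch_mul_qFactInv hb n

theorem qPochInf_eq_qPoch_mul {q : ℤ⟦X⟧} (hq : constantCoeff q = 0) (a : ℤ⟦X⟧) (n : ℕ) :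
    qPochInf a q = qPoch a q n * qPochInf (a * q ^ n) q := by
  have h : (fun t => 1 - a * q ^ n * q ^ t) = fun t => 1 - a * q ^ (t + n) := by
    ext1 t
    ring
  have hm := multipliable_qPochInf (a * q ^ n) q hq
  rw [qPochInf, qPochInf, qPoch, h]
  rw [h] at hm
  exact (Multipliable.prod_mul_tprod_nat_mul' hm).symm

theorem tendsto_qPoch {q : ℤ⟦X⟧} (hq : constantCoeff q = 0) (a : ℤ⟦X⟧) :
    Filter.Tendsto (qPoch a q) Filter.atTop (nhds (qPochInf a q)) :=
  (multipliable_qPochInf a q hq).hasProd.tendsto_prod_nat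

theorem qPochInf_mul_qPochInf_neg {q : ℤ⟦X⟧} (hq : constantCoeff q = 0) (a : ℤ⟦X⟧) :
    qPochInf a q * qPochInf (-a) q = qPochInf (a ^ 2) (q ^ 2) := by
  rw [qPochInf, qPochInf, qPochInf,
    ← (multipliable_qPochInf a q hq).tprod_mul (multipliable_qPochInf (-a) q hq)]
  congr 1
  ext1 t
  ring

theorem qPochInf_eq_mul_sq {q : ℤ⟦X⟧} (hq : constantCoeff q = 0) (a : ℤ⟦X⟧) :
    qPochInf a q = qPochInf a (q ^ 2) * qPochInf (a * q) (q ^ 2) := by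
  have hq2 : constantCoeff (q ^ 2) = 0 := by simp [hq]
  have h₁ := multipliable_qPochInf a (q ^ 2) hq2
  have h₂ := multipliable_qPochInf (a * q) (q ^ 2) hq2
  have e₁ : (fun t => 1 - a * (q ^ 2) ^ t) = fun t => 1 - a * q ^ (2 * t) := by
    ext1 t
    ring
  have e₂ : (fun t => 1 - a * q * (q ^ 2) ^ t) = fun t => 1 - a * q ^ (2 * t + 1) := by
    ext1 t
    ring
  rw [e₁] at h₁
  rw [e₂] at h₂
  rw [qPochInf, qPochInf, qPochInf, e₁, e₂]
  exact (tprod_even_mul_odd (f := fun t => 1 - a * q ^ t) h₁ h₂).symm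

/-! ### Euler's expansion of the infinite Pochhammer symbol -/

theorem choose_add_two (m n : ℕ) : (m + n).choose 2 = m.choose 2 + n.choose 2 + m * n := by
  induction n with
  | zero => simp
  | succ n ih =>
    rw [← add_assoc, Nat.choose_succ_succ' (m + n) 1, Nat.choose_succ_succ' n 1, ih]
    simp
    ring

theorem choose_succ_two (n : ℕ) : (n + 1).choose 2 = n.choose 2 + n := by
  simp [choose_add_two]

/-- The summand `c ^ n b ^ (n (n - 1) / 2) / (b; b)_n` of Euler's expansion of `(-c; b)_∞`. -/
noncomputable def eulerTerm (b c : ℤ⟦X⟧) (n : ℕ) : ℤ⟦X⟧ :=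
  c ^ n * b ^ n.choose 2 * qFactInv b n

theorem X_pow_dvd_pow {b : ℤ⟦X⟧} (hb : constantCoeff b = 0) {m n : ℕ} (h : m ≤ n) :
    (X : ℤ⟦X⟧) ^ m ∣ b ^ n :=
  (pow_dvd_pow X h).trans (pow_dvd_pow_of_dvd (X_dvd_iff.mpr hb) n)

theorem le_choose_succ_two (n : ℕ) : n ≤ (n + 1).choose 2 := by
  rw [choose_succ_two]
  omega

theorem eulerTerm_succ {b : ℤ⟦X⟧} (hb : constantCoeff b = 0) (c : ℤ⟦X⟧) (n : ℕ) :
    (1 - b ^ (n + 1)) * eulerTerm b c (n + 1) = c * b ^ n * eulerTerm b c n := by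
  rw [eulerTerm, eulerTerm, choose_succ_two, ← one_sub_mul_qFactInv_succ hb n]
  ring

theorem eulerTerm_mul_pow (b c : ℤ⟦X⟧) (m n : ℕ) :
    eulerTerm b (c * b ^ m) n = b ^ (m * n) * eulerTerm b c n := by
  rw [eulerTerm, eulerTerm]
  ring

theorem summable_eulerTerm {b : ℤ⟦X⟧} (hb : constantCoeff b = 0) (c : ℤ⟦X⟧) :
    Summable (eulerTerm b c) := by
  refine summable_of_X_pow_dvd (fun n => n.choose 2) (fun d => ?_) fun n => ?_
  · refine (Set.finite_Iic (d + 1)).subset fun n hn => ?_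
    rcases n with _ | n
    · simp
    · have := (le_choose_succ_two n).trans hn
      simpa using this
  · exact Dvd.dvd.mul_right (Dvd.dvd.mul_left (X_pow_dvd_pow hb le_rfl) _) _

/-- This is the functional equation f(c) = (1 + c) f(cb) of (-c; b)_∞. Iterating it gives f(c) =
(-c; b)_n f(cb^n), and f(cb^n) → 1. -/
theorem tsum_eulerTerm_eq {b : ℤ⟦X⟧} (hb : constantCoeff b = 0) (c : ℤ⟦X⟧) :
    ∑' n, eulerTerm b c n = (1 + c) * ∑' n, eulerTerm b (c * b) n := by
  have h (n : ℕ) : eulerTerm b (c * b) n = b ^ n * eulerTerm b c n := by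
    simpa using eulerTerm_mul_pow b c 1 n
  have h₁ := (summable_eulerTerm hb c).tsum_eq_zero_add
  have h₂ := (summable_eulerTerm hb (c * b)).tsum_eq_zero_add
  have h₃ : ∑' n, eulerTerm b c (n + 1) - ∑' n, eulerTerm b (c * b) (n + 1)
      = c * ∑' n, eulerTerm b (c * b) n := by
    rw [← (summable_eulerTerm hb (c * b)).tsum_mul_left, ← Summable.tsum_sub
      ((summable_nat_add_iff 1).mpr (summable_eulerTerm hb c))
      ((summable_nat_add_iff 1).mpr (summable_eulerTerm hb (c * b)))]
    refine tsum_congr fun n => ?_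
    rw [h, h]
    linear_combination eulerTerm_succ hb c n
  have h₄ : eulerTerm b c 0 = eulerTerm b (c * b) 0 := by simp [eulerTerm]
  linear_combination h₁ - h₂ + h₃ + h₄

theorem tsum_eulerTerm_eq_qPoch_mul {b : ℤ⟦X⟧} (hb : constantCoeff b = 0) (c : ℤ⟦X⟧) (n : ℕ) :
    ∑' m, eulerTerm b c m = qPoch (-c) b n * ∑' m, eulerTerm b (c * b ^ n) m := by
  induction n with
  | zero => simp [qPoch]
  | succ n ih =>
    rw [ih, tsum_eulerTerm_eq hb, qPoch_succ, pow_succ, mul_assoc c]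
    ring

theorem hasSum_eulerTerm {b : ℤ⟦X⟧} (hb : constantCoeff b = 0) (c : ℤ⟦X⟧) :
    HasSum (eulerTerm b c) (qPochInf (-c) b) := by
  have hlim : Filter.Tendsto (fun n => ∑' m, eulerTerm b (c * b ^ n) m) Filter.atTop (nhds 1) := by
    refine tendsto_of_X_pow_dvd_sub fun n => ?_
    have hs := summable_eulerTerm hb (c * b ^ n)
    have h0 : eulerTerm b (c * b ^ n) 0 = 1 := by simp [eulerTerm]
    rw [hs.tsum_eq_zero_add, h0, add_sub_cancel_left]
    refine X_pow_dvd_of_hasSum ((summable_nat_add_iff 1).mpr hs).hasSum fun m => ?_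
    rw [eulerTerm_mul_pow]
    exact Dvd.dvd.mul_right (X_pow_dvd_pow hb (Nat.le_mul_of_pos_right n m.succ_pos)) _
  have h := (tendsto_qPoch hb (-c)).mul hlim
  simp_rw [← tsum_eulerTerm_eq_qPoch_mul hb c, mul_one] at h
  rw [← tendsto_nhds_unique tendsto_const_nhds h]
  exact (summable_eulerTerm hb c).hasSum

/-! ### A finite summation -/

/-- The summand `b ^ ((m - l) (n - l)) / ((b; b)_(m - l) (b; b)_(n - l) (b²; b²)_l)`, which is zero
for `l > min m n`. -/
noncomputable def gaussTerm (b : ℤ⟦X⟧) (m n l : ℕ) : ℤ⟦X⟧ :=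
  if l ≤ m ∧ l ≤ n then
    b ^ ((m - l) * (n - l)) * qFactInv b (m - l) * qFactInv b (n - l) * qFactInv (b ^ 2) l
  else 0

theorem gaussTerm_add (b : ℤ⟦X⟧) (j k l : ℕ) :
    gaussTerm b (j + l) (k + l) l
      = b ^ (j * k) * qFactInv b j * qFactInv b k * qFactInv (b ^ 2) l := by
  simp [gaussTerm]

theorem gaussTerm_eq_zero (b : ℤ⟦X⟧) {m n l : ℕ} (h : m < l ∨ n < l) : gaussTerm b m n l = 0 :=
  if_neg (by omega)

theorem gaussTerm_comm (b : ℤ⟦X⟧) (m n l : ℕ) : gaussTerm b m n l = gaussTerm b n m l := by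
  exact if_congr and_comm (by rw [mul_comm (m - l)]; ring) rfl

theorem gaussTerm_succ_succ_succ {b : ℤ⟦X⟧} (hb : constantCoeff b = 0) (m n l : ℕ) :
    (1 - b ^ (2 * (l + 1))) * gaussTerm b (m + 1) (n + 1) (l + 1) = gaussTerm b m n l := by
  have hb2 : constantCoeff (b ^ 2) = 0 := by simp [hb]
  simp only [gaussTerm, Nat.add_le_add_iff_right, Nat.add_sub_add_right]
  split_ifs with h
  · rw [← one_sub_mul_qFactInv_succ hb2 l]
    ring
  · simp

theorem gaussTerm_succ_left {b : ℤ⟦X⟧} (hb : constantCoeff b = 0) (m n l : ℕ) :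
    (1 - b ^ (m + 1 - l)) * gaussTerm b (m + 1) n l = b ^ (n - l) * gaussTerm b m n l := by
  by_cases hl : l ≤ m ∧ l ≤ n
  · obtain ⟨⟨j, rfl⟩, ⟨k, rfl⟩⟩ := And.intro (Nat.exists_eq_add_of_le' hl.1)
      (Nat.exists_eq_add_of_le' hl.2)
    have e : j + l + 1 = j + 1 + l := by omega
    rw [e, gaussTerm_add, gaussTerm_add, Nat.add_sub_cancel, Nat.add_sub_cancel,
      ← one_sub_mul_qFactInv_succ hb j]
    ring
  · rw [gaussTerm_eq_zero b (m := m) (by omega), mul_zero]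
    by_cases hl' : l = m + 1
    · simp [hl']
    · rw [gaussTerm_eq_zero b (by omega), mul_zero]

theorem gaussTerm_succ_right {b : ℤ⟦X⟧} (hb : constantCoeff b = 0) (m n l : ℕ) :
    (1 - b ^ (n + 1 - l)) * gaussTerm b m (n + 1) l = b ^ (m - l) * gaussTerm b m n l := by
  rw [gaussTerm_comm, gaussTerm_succ_left hb, gaussTerm_comm]

theorem one_sub_pow_succ_ne_zero {b : ℤ⟦X⟧} (hb : constantCoeff b = 0) (n : ℕ) :
    1 - b ^ (n + 1) ≠ 0 := by
  intro h
  have := congrArg constantCoeff h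
  simp [hb] at this

/-- The difference of the two summands telescopes, after writing 1 - b^(n+1+l) = (1 - b^(n+1-l)) +
b^(n+1-l) (1 - b^(2l)). The bound m ≤ K makes the range contain the whole support. -/
theorem sum_gaussTerm_eq_sum_mul {b : ℤ⟦X⟧} (hb : constantCoeff b = 0) {m K : ℕ} (hm : m ≤ K)
    (n : ℕ) :
    ∑ l ∈ Finset.range (K + 1), gaussTerm b m n l
      = ∑ l ∈ Finset.range (K + 1), (1 - b ^ (n + 1 + l)) * gaussTerm b m (n + 1) l := by
  rcases m with _ | m
  · refine Finset.sum_congr rfl fun l _ => ?_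
    rcases l with _ | l
    · simpa using (gaussTerm_succ_right hb 0 n 0).symm
    · rw [gaussTerm_eq_zero b (by omega), gaussTerm_eq_zero b (by omega), mul_zero]
  · set D : ℕ → ℤ⟦X⟧ := fun l =>
      b ^ (n + 1 - l) * ((1 - b ^ (2 * l)) * gaussTerm b (m + 1) (n + 1) l) with hD
    have hDsucc (l : ℕ) : D (l + 1) = b ^ (n - l) * gaussTerm b m n l := by
      simp only [hD]
      rw [gaussTerm_succ_succ_succ hb, Nat.add_sub_add_right]
    have hterm (l : ℕ) : (1 - b ^ (n + 1 + l)) * gaussTerm b (m + 1) (n + 1) l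
        - gaussTerm b (m + 1) n l = D l - D (l + 1) := by
      by_cases hl : l ≤ n + 1
      · have h₁ := gaussTerm_succ_right hb (m + 1) n l
        have h₂ := gaussTerm_succ_left hb m n l
        have e : b ^ (n + 1 + l) = b ^ (n + 1 - l) * b ^ (2 * l) := by
          rw [← pow_add]
          congr 1
          omega
        rw [hDsucc]
        simp only [hD]
        linear_combination h₁ - h₂ - gaussTerm b (m + 1) (n + 1) l * e
      · rw [hDsucc]
        simp only [hD]
        rw [gaussTerm_eq_zero b (n := n + 1) (by omega),
          gaussTerm_eq_zero b (m := m + 1) (n := n) (by omega),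
          gaussTerm_eq_zero b (m := m) (n := n) (by omega)]
        simp
    have htel := Finset.sum_range_sub' D (K + 1)
    have h0 : D 0 = 0 := by simp [hD]
    have hK : D (K + 1) = 0 := by rw [hDsucc, gaussTerm_eq_zero b (by omega), mul_zero]
    simp_rw [← hterm] at htel
    rw [Finset.sum_sub_distrib, h0, hK] at htel
    linear_combination -htel

/-- With j = m + 1 - l, split 1 - b^(2(m+1)) = (1 - b^(2l)) + b^(2l) (1 - b^j)(1 + b^j). The first
part lowers m, n and l together, the second lowers m alone; `sum_gaussTerm_eq_sum_mul` brings the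
first back to second index n + 1, so that the two combine. -/
theorem one_sub_mul_sum_gaussTerm {b : ℤ⟦X⟧} (hb : constantCoeff b = 0) {m K : ℕ}
    (hm : m + 1 ≤ K) (n : ℕ) :
    (1 - b ^ (2 * (m + 1))) * ∑ l ∈ Finset.range (K + 1), gaussTerm b (m + 1) n l
      = (1 + b ^ (m + 1 + n)) * ∑ l ∈ Finset.range (K + 1), gaussTerm b m n l := by
  rcases n with _ | n
  · rw [Finset.mul_sum, Finset.mul_sum]
    refine Finset.sum_congr rfl fun l _ => ?_
    rcases l with _ | l
    · have h := gaussTerm_succ_left hb m 0 0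
      simp only [Nat.sub_zero, pow_zero, one_mul] at h
      linear_combination (1 + b ^ (m + 1)) * h
    · rw [gaussTerm_eq_zero b (by omega), gaussTerm_eq_zero b (by omega), mul_zero, mul_zero]
  · have hterm (l : ℕ) : (1 - b ^ (2 * (m + 1))) * gaussTerm b (m + 1) (n + 1) l
        = (1 - b ^ (2 * l)) * gaussTerm b (m + 1) (n + 1) l
          + (b ^ (n + 1 + l) + b ^ (m + 1 + (n + 1))) * gaussTerm b m (n + 1) l := by
      by_cases hl : l ≤ n + 1 ∧ l ≤ m + 1
      · obtain ⟨j, hj⟩ := Nat.exists_eq_add_of_le' hl.2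
        obtain ⟨k, hk⟩ := Nat.exists_eq_add_of_le' hl.1
        have h := gaussTerm_succ_left hb m (n + 1) l
        rw [hj, Nat.add_sub_cancel, hk, Nat.add_sub_cancel] at h
        rw [hj, hk]
        linear_combination (b ^ (2 * l) * (1 + b ^ j)) * h
      · rw [gaussTerm_eq_zero b (by omega), gaussTerm_eq_zero b (by omega)]
        simp
    have hE : ∑ l ∈ Finset.range (K + 1), (1 - b ^ (2 * l)) * gaussTerm b (m + 1) (n + 1) l
        = ∑ l ∈ Finset.range (K + 1), gaussTerm b m n l := by
      rw [Finset.sum_range_succ', Finset.sum_range_succ,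
        gaussTerm_eq_zero b (m := m) (n := n) (l := K) (by omega)]
      simp_rw [gaussTerm_succ_succ_succ hb]
      simp
    rw [Finset.mul_sum, Finset.sum_congr rfl fun l _ => hterm l, Finset.sum_add_distrib, hE,
      sum_gaussTerm_eq_sum_mul hb (by omega), Finset.mul_sum, ← Finset.sum_add_distrib]
    exact Finset.sum_congr rfl fun l _ => by ring

theorem qPoch_neg_mul_qFactInv_sq {b : ℤ⟦X⟧} (hb : constantCoeff b = 0) (n : ℕ) :
    qPoch (-b) b n * qFactInv (b ^ 2) n = qFactInv b n := by
  have hb2 : constantCoeff (b ^ 2) = 0 := by simp [hb]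
  have h : qPoch b b n * qPoch (-b) b n = qPoch (b ^ 2) (b ^ 2) n := by
    rw [qPoch, qPoch, qPoch, ← Finset.prod_mul_distrib]
    exact Finset.prod_congr rfl fun t _ => by ring
  have h₁ := qPoch_mul_qFactInv hb2 n
  rw [← h] at h₁
  linear_combination qFactInv b n * h₁
    - qPoch (-b) b n * qFactInv (b ^ 2) n * qPoch_mul_qFactInv hb n

theorem sum_gaussTerm {b : ℤ⟦X⟧} (hb : constantCoeff b = 0) {m K : ℕ} (hm : m ≤ K) (n : ℕ) :
    ∑ l ∈ Finset.range (K + 1), gaussTerm b m n l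
      = qPoch (-b) b (m + n) * qFactInv (b ^ 2) m * qFactInv (b ^ 2) n := by
  have hb2 : constantCoeff (b ^ 2) = 0 := by simp [hb]
  induction m with
  | zero =>
    rw [Finset.sum_eq_single 0]
    · simp [gaussTerm, qPoch_neg_mul_qFactInv_sq hb]
    · exact fun l _ hl => gaussTerm_eq_zero b (by omega)
    · simp
  | succ m ih =>
    refine mul_left_cancel₀ (one_sub_pow_succ_ne_zero hb2 m) ?_
    have h := one_sub_mul_sum_gaussTerm hb hm n
    rw [ih (by omega), ← one_sub_mul_qFactInv_succ hb2 m] at h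
    rw [← pow_mul, h, show m + 1 + n = m + n + 1 by omega, qPoch_succ]
    ring

/-! ### The fourfold sum -/

/-- Exponent bookkeeping for the substitution (j, k, l) ↦ (j + l, k + l, l) in
`weightedSum_tripleSeries`. -/
theorem choose_two_gauss (j k l : ℕ) :
    (j + k + 2 * l).choose 2 + j.choose 2 + k.choose 2
      = l + 2 * (j + l).choose 2 + 2 * (k + l).choose 2 + j * k := by
  have h : l * l = 2 * l.choose 2 + l := by
    induction l with
    | zero => simp
    | succ l ih =>
      rw [choose_succ_two]
      linarith
  rw [two_mul l]
  simp only [choose_add_two]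
  ring_nf
  ring_nf at h
  omega

theorem X_pow_dvd_pow_choose_mul {b : ℤ⟦X⟧} (hb : constantCoeff b = 0) (r : ℤ⟦X⟧) (n : ℕ) :
    X ^ n ∣ b ^ (n + 1).choose 2 * r :=
  Dvd.dvd.mul_right (X_pow_dvd_pow hb (le_choose_succ_two n)) r

theorem X_pow_dvd_pow_choose {b : ℤ⟦X⟧} (hb : constantCoeff b = 0) (n : ℕ) :
    X ^ n ∣ b ^ (n + 1).choose 2 :=
  X_pow_dvd_pow hb (le_choose_succ_two n)

theorem hasSum_mk {A : Type*} [Semiring A] [TopologicalSpace A] (v : ℕ → A) :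
    HasSum (fun n => monomial n (v n)) (PowerSeries.mk v) := by
  simpa using hasSum_of_monomials_self (PowerSeries.mk v)

theorem hasSum_expand_mk (v : ℕ → ℤ⟦X⟧) :
    HasSum (fun l => monomial (2 * l) (v l)) (expand 2 two_ne_zero (PowerSeries.mk v)) :=
  hasSum_monomial_mul two_ne_zero v (fun n => by rw [coeff_expand_mul, coeff_mk])
    fun _ hn => coeff_expand_of_not_dvd _ _ _ hn

theorem finite_mul_le {k : ℕ} (hk : k ≠ 0) (d : ℕ) : {n : ℕ | k * n ≤ d}.Finite :=
  (Set.finite_Iic d).subset fun _ hn => (Nat.le_mul_of_pos_left _ (Nat.pos_of_ne_zero hk)).trans hn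

theorem finite_add_le {ι κ : Type*} {w : ι → ℕ} {w' : κ → ℕ}
    (hw : ∀ d, {p | w p ≤ d}.Finite) (hw' : ∀ d, {p | w' p ≤ d}.Finite) (d : ℕ) :
    {p : ι × κ | w p.1 + w' p.2 ≤ d}.Finite :=
  ((hw d).prod (hw' d)).subset fun p hp => by
    simp only [Set.mem_prod, Set.mem_ofPred_eq] at hp ⊢
    omega

/-- The generating function `1 / (b z; b)_∞ = ∑ i, b ^ i z ^ i / (b; b)_i`. -/
noncomputable def geomSeries (b : ℤ⟦X⟧) : ℤ⟦X⟧⟦X⟧ :=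
  PowerSeries.mk fun i => b ^ i * qFactInv b i

/-- The generating function `1 / (c z²; b)_∞ = ∑ l, c ^ l z ^ (2 l) / (b; b)_l`. -/
noncomputable def geomSeriesSq (b c : ℤ⟦X⟧) : ℤ⟦X⟧⟦X⟧ :=
  expand 2 two_ne_zero (PowerSeries.mk fun l => c ^ l * qFactInv b l)

/-- The generating function `(-c z; b)_∞`. -/
noncomputable def eulerSeries (b c : ℤ⟦X⟧) : ℤ⟦X⟧⟦X⟧ :=
  PowerSeries.mk (eulerTerm b c)

/-- The generating function `(-α z, -β z; b)_∞ / (b z²; b²)_∞`. -/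
noncomputable def tripleSeries (b α β : ℤ⟦X⟧) : ℤ⟦X⟧⟦X⟧ :=
  eulerSeries b α * (eulerSeries b β * geomSeriesSq (b ^ 2) b)

theorem finite_le (d : ℕ) : {n : ℕ | n ≤ d}.Finite := Set.finite_Iic d

theorem hasSum_eulerSeries (b c : ℤ⟦X⟧) :
    HasSum (fun n => monomial n (eulerTerm b c n)) (eulerSeries b c) :=
  hasSum_mk _

theorem hasSum_geomSeriesSq (b c : ℤ⟦X⟧) :
    HasSum (fun l => monomial (2 * l) (c ^ l * qFactInv b l)) (geomSeriesSq b c) :=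
  hasSum_expand_mk _

theorem hasSum_tripleSeries (b α β : ℤ⟦X⟧) :
    HasSum (fun p : ℕ × ℕ × ℕ => monomial (p.1 + (p.2.1 + 2 * p.2.2))
      (eulerTerm b α p.1 * (eulerTerm b β p.2.1 * (b ^ p.2.2 * qFactInv (b ^ 2) p.2.2))))
      (tripleSeries b α β) := by
  have h₁ := hasSum_monomial_mul_monomial (hasSum_eulerSeries b β) (hasSum_geomSeriesSq (b ^ 2) b)
    finite_le (finite_mul_le two_ne_zero)
  have h₂ := hasSum_monomial_mul_monomial (hasSum_eulerSeries b α) h₁ finite_le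
    (finite_add_le finite_le (finite_mul_le two_ne_zero))
  rw [tripleSeries]
  exact h₂

theorem hasSum_geomSeries_mul_tripleSeries (b α β : ℤ⟦X⟧) :
    HasSum (fun p : ℕ × ℕ × ℕ × ℕ => monomial (p.1 + (p.2.1 + (p.2.2.1 + 2 * p.2.2.2)))
      (b ^ p.1 * qFactInv b p.1 * (eulerTerm b α p.2.1 *
        (eulerTerm b β p.2.2.1 * (b ^ p.2.2.2 * qFactInv (b ^ 2) p.2.2.2)))))
      (geomSeries b * tripleSeries b α β) := by
  have h₁ : HasSum (fun i => monomial i (b ^ i * qFactInv b i)) (geomSeries b) := hasSum_mk _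
  have h₂ := hasSum_monomial_mul_monomial h₁ (hasSum_tripleSeries b α β) finite_le
    (finite_add_le finite_le (finite_add_le finite_le (finite_mul_le two_ne_zero)))
  exact h₂

theorem weightedSum_geomSeries_mul {b : ℤ⟦X⟧} (hb : constantCoeff b = 0) (W : ℤ⟦X⟧⟦X⟧) :
    weightedSum (fun n => b ^ n.choose 2) (geomSeries b * W)
      = qPochInf (-b) b * weightedSum
          (fun n => b ^ n.choose 2 * Ring.inverse (qPoch (-b) b n)) W := by
  have hW := hasSum_of_monomials_self W
  have h₁ := hasSum_weightedSum (g := fun n => b ^ n.choose 2) (X_pow_dvd_pow_choose hb)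
    (hasSum_monomial_mul_monomial (w := fun i => i) (w' := fun n => n)
      (hasSum_mk fun i => b ^ i * qFactInv b i) hW finite_le finite_le)
  have h₂ := (hasSum_weightedSum (g := fun n => b ^ n.choose 2 * Ring.inverse (qPoch (-b) b n))
    (fun n => X_pow_dvd_pow_choose_mul hb (Ring.inverse (qPoch (-b) b (n + 1))) n) hW).mul_left
    (qPochInf (-b) b)
  refine HasSum.unique ?_ h₂
  -- The index i of the geometric factor is summed first, for fixed n. Since (n+i choose 2) = (n
  -- choose 2) + (i choose 2) + ni, the inner sum is Euler's expansion of (-b^(n+1); b)_∞ = (-b;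
  -- b)_∞ / (-b; b)_n.
  refine HasSum.prod_fiberwise ((Equiv.prodComm ℕ ℕ).hasSum_iff.mpr h₁) fun n => ?_
  have hu := Ring.mul_inverse_cancel _ (isUnit_qPoch (-b) b (by simp [hb]) n)
  convert (hasSum_eulerTerm hb (b * b ^ n)).mul_left (b ^ n.choose 2 * coeff n W) using 1
  · ext1 i
    simp only [Function.comp_apply, Equiv.prodComm_apply, Prod.swap, choose_add_two]
    rw [eulerTerm]
    ring
  · rw [qPochInf_eq_qPoch_mul hb (-b) n, ← neg_mul]
    linear_combination qPochInf (-b * b ^ n) b * b ^ n.choose 2 * coeff n W * hu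

theorem weightedSum_tripleSeries {b α β : ℤ⟦X⟧} (hb : constantCoeff b = 0) (h : α * β = b ^ 2) :
    weightedSum (fun n => b ^ n.choose 2 * Ring.inverse (qPoch (-b) b n)) (tripleSeries b α β)
      = qPochInf (-α) (b ^ 2) * qPochInf (-β) (b ^ 2) := by
  have hb2 : constantCoeff (b ^ 2) = 0 := by simp [hb]
  set H : (ℕ × ℕ) × ℕ → ℤ⟦X⟧ := fun p =>
    α ^ p.1.1 * β ^ p.1.2 * (b ^ 2) ^ (p.1.1.choose 2 + p.1.2.choose 2) *
      Ring.inverse (qPoch (-b) b (p.1.1 + p.1.2)) * gaussTerm b p.1.1 p.1.2 p.2 with hH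
  -- With m = j + l and n = k + l, the weight index j + k + 2l becomes m + n, independent of l, so
  -- the sum over l involves only `gaussTerm`. Off the range of φ that term vanishes. The hypothesis
  -- αβ = b² converts α^m β^n into α^j β^k b^(2l).
  set φ : ℕ × ℕ × ℕ → (ℕ × ℕ) × ℕ := fun p => ((p.1 + p.2.2, p.2.1 + p.2.2), p.2.2) with hφ
  have hφi : Function.Injective φ := by
    rintro ⟨j, k, l⟩ ⟨j', k', l'⟩ hp
    simp only [hφ, Prod.mk.injEq] at hp ⊢
    omega
  have h₁ := hasSum_weightedSum (g := fun n => b ^ n.choose 2 * Ring.inverse (qPoch (-b) b n))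
    (fun n => X_pow_dvd_pow_choose_mul hb (Ring.inverse (qPoch (-b) b (n + 1))) n)
    (hasSum_tripleSeries b α β)
  have h₂ : HasSum H (weightedSum (fun n => b ^ n.choose 2 * Ring.inverse (qPoch (-b) b n))
      (tripleSeries b α β)) := by
    rw [← hφi.hasSum_iff]
    · convert h₁ using 1
      ext1 ⟨j, k, l⟩
      have e := congrArg (b ^ ·) (choose_two_gauss j k l)
      have e' : α ^ l * β ^ l = b ^ (2 * l) := by rw [← mul_pow, h, ← pow_mul]
      simp only [hH, hφ, Function.comp_apply, gaussTerm_add, eulerTerm]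
      rw [show j + l + (k + l) = j + k + 2 * l by omega, ← add_assoc j k]
      simp only [pow_add, pow_mul] at e e' ⊢
      linear_combination (α ^ j * β ^ k * Ring.inverse (qPoch (-b) b (j + k + 2 * l)) *
          qFactInv b j * qFactInv b k * qFactInv (b ^ 2) l) *
        ((b ^ 2) ^ (j + l).choose 2 * (b ^ 2) ^ (k + l).choose 2 * (b ^ j) ^ k * e' - b ^ l * e)
    · rintro ⟨⟨m, n⟩, l⟩ hp
      simp only [hH]
      rw [gaussTerm_eq_zero, mul_zero]
      by_contra hlt
      refine hp ⟨(m - l, n - l, l), ?_⟩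
      simp only [hφ, Prod.mk.injEq, and_true]
      omega
  have h₃ : HasSum (fun p : ℕ × ℕ => eulerTerm (b ^ 2) α p.1 * eulerTerm (b ^ 2) β p.2)
      (weightedSum (fun n => b ^ n.choose 2 * Ring.inverse (qPoch (-b) b n))
        (tripleSeries b α β)) := by
    refine HasSum.prod_fiberwise h₂ fun ⟨m, n⟩ => ?_
    have hsum : HasSum (gaussTerm b m n) _ := hasSum_sum_of_ne_finset_zero
      (s := Finset.range (m + 1)) fun l hl =>
        gaussTerm_eq_zero b (Or.inl (by simpa [Nat.lt_succ_iff] using hl))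
    rw [sum_gaussTerm hb le_rfl] at hsum
    have hu := Ring.mul_inverse_cancel _ (isUnit_qPoch (-b) b (by simp [hb]) (m + n))
    have h₄ := hsum.mul_left (α ^ m * β ^ n * (b ^ 2) ^ (m.choose 2 + n.choose 2) *
      Ring.inverse (qPoch (-b) b (m + n)))
    have e : α ^ m * β ^ n * (b ^ 2) ^ (m.choose 2 + n.choose 2) *
        Ring.inverse (qPoch (-b) b (m + n)) * (qPoch (-b) b (m + n) * qFactInv (b ^ 2) m *
          qFactInv (b ^ 2) n) = eulerTerm (b ^ 2) α m * eulerTerm (b ^ 2) β n := by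
      simp only [eulerTerm, pow_add]
      linear_combination (α ^ m * β ^ n * (b ^ 2) ^ m.choose 2 * (b ^ 2) ^ n.choose 2 *
        qFactInv (b ^ 2) m * qFactInv (b ^ 2) n) * hu
    rw [e] at h₄
    exact h₄
  exact (HasSum.mul_eq (hasSum_eulerTerm hb2 α) (hasSum_eulerTerm hb2 β) h₃).symm

theorem weightedSum_geomSeries_mul_tripleSeries {b α β : ℤ⟦X⟧} (hb : constantCoeff b = 0)
    (h : α * β = b ^ 2) :
    weightedSum (fun n => b ^ n.choose 2) (geomSeries b * tripleSeries b α β)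
      = qPochInf (-b) b * (qPochInf (-α) (b ^ 2) * qPochInf (-β) (b ^ 2)) := by
  rw [weightedSum_geomSeries_mul hb, weightedSum_tripleSeries hb h]

/-! ### Functional equations of the generating functions -/

/-- The equation determines a series from its constant term: if E = F - G vanishes below degree n >
0, comparing coefficients of degree n gives (b^n - 1) coeff n E = 0, and b^n ≠ 1. -/
theorem eq_of_rescale_eq {b : ℤ⟦X⟧} (hb : constantCoeff b = 0) {u v F G : ℤ⟦X⟧⟦X⟧}
    (hu : constantCoeff u = 1) (hv : constantCoeff v = 1) (hF : u * rescale b F = v * F)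
    (hG : u * rescale b G = v * G) (h : constantCoeff F = constantCoeff G) : F = G := by
  have hD : u * rescale b (F - G) = v * (F - G) := by
    rw [map_sub]
    linear_combination hF - hG
  have lead (w E : ℤ⟦X⟧⟦X⟧) (hw : constantCoeff w = 1) (n : ℕ) (hE : ∀ m < n, coeff m E = 0) :
      coeff n (w * E) = coeff n E := by
    rw [coeff_mul, Finset.sum_eq_single (0, n)]
    · simp [hw]
    · rintro ⟨i, j⟩ hij hne
      rw [Finset.HasAntidiagonal.mem_antidiagonal] at hij
      rw [hE j, mul_zero]
      by_contra hj
      exact hne (Prod.ext (by simp only at hij ⊢; omega) (by simp only at hij ⊢; omega))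
    · simp
  suffices h0 : ∀ n, coeff n (F - G) = 0 from sub_eq_zero.mp (PowerSeries.ext fun n => by simp [h0])
  intro n
  induction n using Nat.strong_induction_on with
  | _ n ih =>
    rcases n with _ | n
    · simp [h]
    · have hn := congrArg (coeff (n + 1)) hD
      rw [lead u _ hu _ fun m hm => by rw [coeff_rescale, ih m hm, mul_zero],
        lead v _ hv _ ih, coeff_rescale] at hn
      refine (mul_eq_zero.mp ?_).resolve_left (one_sub_pow_succ_ne_zero hb n)
      linear_combination -hn

theorem rescale_C {A : Type*} [CommRing A] (b c : A) : rescale b (C c) = C c := by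
  ext1 n
  rw [coeff_rescale, coeff_C]
  split_ifs with h <;> simp [h]

theorem rescale_one_add_C_mul_X {A : Type*} [CommRing A] (b c : A) :
    rescale b (1 + C c * X) = 1 + C (c * b) * X := by
  rw [map_add, map_one, map_mul, rescale_X, rescale_C, map_mul C, mul_assoc]

theorem eulerSeries_eq {b : ℤ⟦X⟧} (hb : constantCoeff b = 0) (c : ℤ⟦X⟧) :
    eulerSeries b c = (1 + C c * X) * rescale b (eulerSeries b c) := by
  ext1 n
  rw [add_mul, one_mul, map_add, mul_assoc, coeff_C_mul, coeff_rescale]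
  rcases n with _ | n
  · simp
  · rw [coeff_succ_X_mul, coeff_rescale, eulerSeries, coeff_mk, coeff_mk]
    linear_combination eulerTerm_succ hb c n

theorem eulerSeries_eq_cube {b : ℤ⟦X⟧} (hb : constantCoeff b = 0) (c : ℤ⟦X⟧) :
    eulerSeries b c = (1 + C c * X) * (1 + C (c * b) * X) * (1 + C (c * b * b) * X) *
      rescale (b ^ 3) (eulerSeries b c) := by
  have h₁ := eulerSeries_eq hb c
  have h₂ := congrArg (rescale b) h₁
  have h₃ := congrArg (rescale b) h₂
  simp only [map_mul (rescale b), rescale_one_add_C_mul_X, rescale_rescale] at h₂ h₃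
  rw [show b ^ 3 = b * b * b by ring]
  linear_combination h₁ + (1 + C c * X) * h₂ + (1 + C c * X) * (1 + C (c * b) * X) * h₃

theorem rescale_mk_pow_mul_qFactInv {b : ℤ⟦X⟧} (hb : constantCoeff b = 0) (c : ℤ⟦X⟧) :
    rescale b (PowerSeries.mk fun l => c ^ l * qFactInv b l)
      = (1 - C c * X) * PowerSeries.mk fun l => c ^ l * qFactInv b l := by
  ext1 n
  rw [sub_mul, one_mul, map_sub, mul_assoc, coeff_C_mul, coeff_rescale]
  rcases n with _ | n
  · simp
  · rw [coeff_succ_X_mul, coeff_mk, coeff_mk, ← one_sub_mul_qFactInv_succ hb n]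
    ring

theorem rescale_geomSeries {b : ℤ⟦X⟧} (hb : constantCoeff b = 0) :
    rescale b (geomSeries b) = (1 - C b * X) * geomSeries b :=
  rescale_mk_pow_mul_qFactInv hb b

theorem rescale_expand_two {A : Type*} [CommRing A] (b : A) (F : A⟦X⟧) :
    rescale b (expand 2 two_ne_zero F) = expand 2 two_ne_zero (rescale (b ^ 2) F) := by
  ext1 n
  rw [coeff_rescale, coeff_expand, coeff_expand]
  split_ifs with h
  · obtain ⟨m, rfl⟩ := h
    rw [Nat.mul_div_cancel_left m two_pos, coeff_rescale, pow_mul]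
  · rw [mul_zero]

theorem rescale_geomSeriesSq_sq {b : ℤ⟦X⟧} (hb : constantCoeff b = 0) (c : ℤ⟦X⟧) :
    rescale b (geomSeriesSq (b ^ 2) c) = (1 - C c * X ^ 2) * geomSeriesSq (b ^ 2) c := by
  rw [geomSeriesSq, rescale_expand_two, rescale_mk_pow_mul_qFactInv (by simp [hb])]
  simp only [map_mul, map_sub, map_one, expand_C, expand_X]

theorem rescale_geomSeriesSq {b : ℤ⟦X⟧} (hb : constantCoeff b = 0) (c : ℤ⟦X⟧) :
    rescale b (geomSeriesSq b c)
      = (1 - C (c * b) * X ^ 2) * (1 - C c * X ^ 2) * geomSeriesSq b c := by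
  rw [geomSeriesSq, rescale_expand_two, sq b, ← rescale_rescale, rescale_mk_pow_mul_qFactInv hb,
    map_mul (rescale b), rescale_mk_pow_mul_qFactInv hb]
  simp only [map_mul, map_sub, map_one, expand_C, expand_X, rescale_C, rescale_X]
  ring

theorem rescale_geomSeries_mul_tripleSeries {b : ℤ⟦X⟧} (hb : constantCoeff b = 0) (α β : ℤ⟦X⟧) :
    (1 + C α * X) * (1 + C β * X) * rescale b (geomSeries b * tripleSeries b α β)
      = (1 - C b * X) * (1 - C b * X ^ 2) * (geomSeries b * tripleSeries b α β) := by
  simp only [tripleSeries, map_mul (rescale b), rescale_geomSeries hb, rescale_geomSeriesSq_sq hb]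
  conv_rhs => rw [eulerSeries_eq hb α, eulerSeries_eq hb β]
  ring

/-- The generating function `(-c z; q)_∞ / (q³ z²; q³)_∞`, where `q` is the base variable. -/
noncomputable def doubleSeries (c : ℤ⟦X⟧) : ℤ⟦X⟧⟦X⟧ :=
  eulerSeries X c * geomSeriesSq (X ^ 3) (X ^ 3)

theorem rescale_doubleSeries (c : ℤ⟦X⟧) :
    (1 + C c * X) * (1 + C (c * X) * X) * (1 + C (c * X * X) * X) *
        rescale (X ^ 3) (doubleSeries c)
      = (1 - C (X ^ 3) * X) * (1 + C (X ^ 3) * X) * (1 - C (X ^ 3) * X ^ 2) * doubleSeries c := by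
  rw [doubleSeries, map_mul (rescale _), rescale_geomSeriesSq (by simp)]
  conv_rhs => rw [eulerSeries_eq_cube (b := X) (by simp) c]
  simp only [map_mul, map_pow]
  ring

theorem constantCoeff_eulerSeries (b c : ℤ⟦X⟧) : constantCoeff (eulerSeries b c) = 1 := by
  rw [← coeff_zero_eq_constantCoeff_apply, eulerSeries, coeff_mk]
  simp [eulerTerm]

theorem constantCoeff_geomSeries (b : ℤ⟦X⟧) : constantCoeff (geomSeries b) = 1 := by
  rw [← coeff_zero_eq_constantCoeff_apply, geomSeries, coeff_mk]
  simp

theorem constantCoeff_geomSeriesSq (b c : ℤ⟦X⟧) : constantCoeff (geomSeriesSq b c) = 1 := by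
  rw [geomSeriesSq, constantCoeff_expand, ← coeff_zero_eq_constantCoeff_apply, coeff_mk]
  simp

/-- As products, (-q²z; q)_∞ = (-q²z, -q³z, -q⁴z; q³)_∞ and (q³z²; q³)_∞ = (q³z²; q⁶)_∞ (q³z, -q³z;
q³)_∞, so (-q³z; q³)_∞ cancels. The proof compares functional equations under z ↦ q³z, where the
cancelled product survives as the common factor 1 + q³z. -/
theorem doubleSeries_X_sq :
    doubleSeries (X ^ 2) = geomSeries (X ^ 3) * tripleSeries (X ^ 3) (X ^ 2) (X ^ 4) := by
  refine eq_of_rescale_eq (b := X ^ 3) (by simp) (by simp) (by simp)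
    (rescale_doubleSeries (X ^ 2)) ?_ ?_
  · have h := rescale_geomSeries_mul_tripleSeries (b := X ^ 3) (by simp) (X ^ 2) (X ^ 4)
    simp only [map_mul C, map_pow C] at h ⊢
    linear_combination (1 + C X ^ 3 * X) * h
  · simp [doubleSeries, tripleSeries, constantCoeff_eulerSeries, constantCoeff_geomSeries,
      constantCoeff_geomSeriesSq]

/-- The same cancellation; here the factor 1 + qz completes (-q⁴z; q³)_∞ to (-qz; q³)_∞. -/
theorem one_add_mul_doubleSeries_X_cube :
    (1 + C X * X) * doubleSeries (X ^ 3)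
      = geomSeries (X ^ 3) * tripleSeries (X ^ 3) (X ^ 5) X := by
  refine eq_of_rescale_eq (b := X ^ 3)
    (u := (1 + C X * X) * (1 + C (X ^ 3) * X) * (1 + C (X ^ 5) * X))
    (v := (1 - C (X ^ 3) * X) * (1 + C (X ^ 3) * X) * (1 - C (X ^ 3) * X ^ 2))
    (by simp) (by simp) (by simp) ?_ ?_ ?_
  · have h := rescale_doubleSeries (X ^ 3)
    rw [map_mul (rescale _), rescale_one_add_C_mul_X]
    simp only [map_mul C, map_pow C] at h ⊢
    linear_combination (1 + C X * X) * h
  · have h := rescale_geomSeries_mul_tripleSeries (b := X ^ 3) (by simp) (X ^ 5) X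
    simp only [map_pow C] at h ⊢
    linear_combination (1 + C X ^ 3 * X) * h
  · simp [doubleSeries, tripleSeries, constantCoeff_eulerSeries, constantCoeff_geomSeries,
      constantCoeff_geomSeriesSq]

/-! ### The sums of the theorem -/

theorem two_mul_choose_two (n : ℕ) : 2 * n.choose 2 + n = n ^ 2 := by
  induction n with
  | zero => simp
  | succ n ih =>
    rw [choose_succ_two]
    linarith

theorem psDiv_mul (f g h : ℤ⟦X⟧) :
    psDiv f (g * h) = f * (Ring.inverse g * Ring.inverse h) := by
  rw [psDiv, Ring.mul_inverse_rev, mul_comm (Ring.inverse h)]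

theorem hasSum_doubleSeries (c : ℤ⟦X⟧) :
    HasSum (fun p : ℕ × ℕ => monomial (p.1 + 2 * p.2)
      (eulerTerm X c p.1 * ((X ^ 3) ^ p.2 * qFactInv (X ^ 3) p.2))) (doubleSeries c) := by
  rw [doubleSeries]
  have h := hasSum_monomial_mul_monomial (hasSum_eulerSeries X c)
    (hasSum_geomSeriesSq (X ^ 3) (X ^ 3)) finite_le (finite_mul_le two_ne_zero)
  exact h

theorem X_pow_dvd_X_cube_pow_choose (n : ℕ) :
    (X : ℤ⟦X⟧) ^ n ∣ (X ^ 3) ^ (n + 1).choose 2 :=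
  X_pow_dvd_pow_choose (by simp) n

theorem three_mul_choose_two_add (i j : ℕ) :
    3 * (i + 2 * j).choose 2 + i.choose 2 + 2 * i + 3 * j = 2 * i ^ 2 + 6 * i * j + 6 * j ^ 2 := by
  have h₁ := two_mul_choose_two (i + 2 * j)
  have h₂ := two_mul_choose_two i
  have h₃ : (i + 2 * j) ^ 2 = i ^ 2 + 4 * (i * j) + 4 * j ^ 2 := by ring
  rw [mul_assoc 6 i j]
  omega

theorem hasSum_cap1Term :
    HasSum cap1Term (weightedSum (fun n => (X ^ 3) ^ n.choose 2) (doubleSeries (X ^ 2))) := by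
  convert hasSum_weightedSum (g := fun n => (X ^ 3) ^ n.choose 2) X_pow_dvd_X_cube_pow_choose
    (hasSum_doubleSeries (X ^ 2)) using 1
  ext1 ⟨i, j⟩
  rw [cap1Term, psDiv_mul, ← three_mul_choose_two_add]
  simp only [eulerTerm, qFactInv]
  ring

theorem hasSum_cap2TermA :
    HasSum cap2TermA (weightedSum (fun n => (X ^ 3) ^ n.choose 2) (doubleSeries (X ^ 3))) := by
  convert hasSum_weightedSum (g := fun n => (X ^ 3) ^ n.choose 2) X_pow_dvd_X_cube_pow_choose
    (hasSum_doubleSeries (X ^ 3)) using 1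
  ext1 ⟨i, j⟩
  rw [cap2TermA, psDiv_mul, ← three_mul_choose_two_add]
  simp only [eulerTerm, qFactInv]
  ring

theorem hasSum_C_X_mul_X_mul_doubleSeries (c : ℤ⟦X⟧) :
    HasSum (fun p : ℕ × ℕ => monomial (1 + (p.1 + 2 * p.2))
      (X * (eulerTerm X c p.1 * ((X ^ 3) ^ p.2 * qFactInv (X ^ 3) p.2))))
      (C X * X * doubleSeries c) := by
  have h := (hasSum_doubleSeries c).mul_left (monomial 1 (X : ℤ⟦X⟧))
  simp only [monomial_mul_monomial] at h
  have e : monomial 1 (X : ℤ⟦X⟧) = C X * X := by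
    ext1 n
    rw [coeff_C_mul, coeff_X, coeff_monomial, mul_ite, mul_one, mul_zero]
  rwa [e] at h

/-- The extra factor qz raises the weight index i + 2j by one, which multiplies each summand of
`cap2TermA` by q^(1 + 3(i + 2j)). -/
theorem hasSum_cap2TermB :
    HasSum cap2TermB
      (weightedSum (fun n => (X ^ 3) ^ n.choose 2) (C X * X * doubleSeries (X ^ 3))) := by
  convert hasSum_weightedSum (g := fun n => (X ^ 3) ^ n.choose 2) X_pow_dvd_X_cube_pow_choose
    (hasSum_C_X_mul_X_mul_doubleSeries (X ^ 3)) using 1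
  ext1 ⟨i, j⟩
  rw [cap2TermB, psDiv_mul, ← three_mul_choose_two_add]
  simp only [eulerTerm, qFactInv, add_comm 1, choose_succ_two]
  ring

theorem cap2Exponent_eq (i j k l : ℕ) :
    cap2Exponent i j k l = 3 * (i + (j + (k + 2 * l))).choose 2 + 3 * i
      + (5 * j + 3 * j.choose 2) + (k + 3 * k.choose 2) + 3 * l := by
  have h (n : ℕ) : 3 * n * (n - 1) / 2 = 3 * n.choose 2 := by
    rcases n with _ | n
    · simp
    · have := two_mul_choose_two (n + 1)
      rw [Nat.add_sub_cancel, mul_assoc]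
      have e : (n + 1) ^ 2 = (n + 1) * n + (n + 1) := by ring
      omega
  rw [cap2Exponent, h, h, h, show i + (j + (k + 2 * l)) = i + j + k + 2 * l by omega]
  ring

theorem hasSum_cap2TermFour :
    HasSum cap2TermFour (weightedSum (fun n => (X ^ 3) ^ n.choose 2)
      (geomSeries (X ^ 3) * tripleSeries (X ^ 3) (X ^ 5) X)) := by
  convert hasSum_weightedSum (g := fun n => (X ^ 3) ^ n.choose 2) X_pow_dvd_X_cube_pow_choose
    (hasSum_geomSeries_mul_tripleSeries (X ^ 3) (X ^ 5) X) using 1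
  ext1 ⟨i, j, k, l⟩
  rw [cap2TermFour, psDiv_mul, Ring.mul_inverse_rev, Ring.mul_inverse_rev, cap2Exponent_eq]
  simp only [eulerTerm, qFactInv, ← pow_mul, Nat.reduceMul]
  ring

/-! ### The products of the theorem -/

/-- Apply (a; q)_∞ (-a; q)_∞ = (a²; q²)_∞ to each factor on the left and split the results into
residue classes modulo 12. In `c₂` the products (q⁴; q¹²)_∞ and (q⁸; q¹²)_∞ occur on both sides and
cancel. -/
theorem qPochInf_X_cube_mul :
    qPochInf (-X ^ 3) (X ^ 3) * (qPochInf (-X ^ 2) (X ^ 6) * qPochInf (-X ^ 4) (X ^ 6))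
      = psDiv 1 (qPochInfList [X ^ 2, X ^ 3, X ^ 9, X ^ 10] (X ^ 12)) := by
  have inf_ne (m : ℕ) : qPochInf (X ^ (m + 1)) (X ^ 12) ≠ 0 :=
    (isUnit_qPochInf _ _ (by simp) (by simp)).ne_zero
  have inf_ne' : qPochInf (X ^ 6) (X ^ 6) ≠ 0 :=
    (isUnit_qPochInf _ _ (by simp) (by simp)).ne_zero
  have hu := Ring.mul_inverse_cancel _ (isUnit_qPochInfList [X ^ 2, X ^ 3, X ^ 9, X ^ 10] (X ^ 12)
    (by simp) (by simp))
  have a₁ := qPochInf_mul_qPochInf_neg (q := X ^ 3) (by simp) (X ^ 3)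
  have a₂ := qPochInf_mul_qPochInf_neg (q := X ^ 6) (by simp) (X ^ 2)
  have a₃ := qPochInf_mul_qPochInf_neg (q := X ^ 6) (by simp) (X ^ 4)
  have b₁ := qPochInf_eq_mul_sq (q := X ^ 3) (by simp) (X ^ 3)
  have b₂ := qPochInf_eq_mul_sq (q := X ^ 6) (by simp) (X ^ 2)
  have b₃ := qPochInf_eq_mul_sq (q := X ^ 6) (by simp) (X ^ 4)
  have b₄ := qPochInf_eq_mul_sq (q := X ^ 6) (by simp) (X ^ 3)
  simp only [← pow_mul, ← pow_add, Nat.reduceMul, Nat.reduceAdd] at a₁ a₂ a₃ b₁ b₂ b₃ b₄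
  rw [b₁, b₄] at a₁
  rw [b₂] at a₂
  rw [b₃] at a₃
  have c₁ : qPochInf (X ^ 3) (X ^ 12) * qPochInf (X ^ 9) (X ^ 12) *
      qPochInf (-X ^ 3) (X ^ 3) = 1 :=
    mul_left_cancel₀ inf_ne' (by linear_combination a₁)
  have c₂ : qPochInf (X ^ 2) (X ^ 12) * qPochInf (X ^ 10) (X ^ 12) *
      (qPochInf (-X ^ 2) (X ^ 6) * qPochInf (-X ^ 4) (X ^ 6)) = 1 :=
    mul_left_cancel₀ (mul_ne_zero (inf_ne 3) (inf_ne 7)) (by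
      linear_combination (qPochInf (X ^ 4) (X ^ 12) * qPochInf (X ^ 10) (X ^ 12) *
        qPochInf (-X ^ 4) (X ^ 6)) * a₂ + qPochInf (X ^ 4) (X ^ 12) * a₃)
  have c₃ : qPochInfList [X ^ 2, X ^ 3, X ^ 9, X ^ 10] (X ^ 12) =
      qPochInf (X ^ 2) (X ^ 12) * qPochInf (X ^ 3) (X ^ 12) * qPochInf (X ^ 9) (X ^ 12) *
        qPochInf (X ^ 10) (X ^ 12) := by
    simp [qPochInfList, mul_assoc]
  rw [psDiv, one_mul]
  refine mul_left_cancel₀ (isUnit_qPochInfList [X ^ 2, X ^ 3, X ^ 9, X ^ 10] (X ^ 12)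
    (by simp) (by simp)).ne_zero ?_
  rw [hu, c₃]
  linear_combination (qPochInf (X ^ 2) (X ^ 12) * qPochInf (X ^ 10) (X ^ 12) *
    (qPochInf (-X ^ 2) (X ^ 6) * qPochInf (-X ^ 4) (X ^ 6))) * c₁ + c₂

theorem qPochInf_X_mul :
    qPochInf (-X ^ 3) (X ^ 3) * (qPochInf (-X) (X ^ 6) * qPochInf (-X ^ 5) (X ^ 6))
      = qPochInfList [-X, -X ^ 3, -X ^ 5, -X ^ 6] (X ^ 6) := by
  have h := qPochInf_eq_mul_sq (q := X ^ 3) (by simp) (-X ^ 3)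
  simp only [neg_mul, ← pow_mul, ← pow_add, Nat.reduceMul, Nat.reduceAdd] at h
  rw [h]
  simp only [qPochInfList, List.map_cons, List.map_nil, List.prod_cons, List.prod_nil]
  ring

theorem mainTheorem1 :
    (Summable cap1Term ∧
      ∑' p, cap1Term p = psDiv 1 (qPochInfList [X ^ 2, X ^ 3, X ^ 9, X ^ 10] (X ^ 12))) ∧
    (Summable cap2TermFour ∧ Summable cap2TermA ∧ Summable cap2TermB ∧
      (∑' p, cap2TermFour p) = (∑' p, cap2TermA p) + (∑' p, cap2TermB p) ∧
      (∑' p, cap2TermA p) + (∑' p, cap2TermB p) =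
        qPochInfList [-X, -X ^ 3, -X ^ 5, -X ^ 6] (X ^ 6)) := by
  have hfour : (∑' p, cap2TermFour p) = (∑' p, cap2TermA p) + (∑' p, cap2TermB p) := by
    rw [hasSum_cap2TermFour.tsum_eq, hasSum_cap2TermA.tsum_eq, hasSum_cap2TermB.tsum_eq,
      ← map_add]
    congr 1
    linear_combination -one_add_mul_doubleSeries_X_cube
  refine ⟨⟨hasSum_cap1Term.summable, ?_⟩, hasSum_cap2TermFour.summable, hasSum_cap2TermA.summable,
    hasSum_cap2TermB.summable, hfour, ?_⟩
  · rw [hasSum_cap1Term.tsum_eq, doubleSeries_X_sq,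
      weightedSum_geomSeries_mul_tripleSeries (by simp) (by ring), ← qPochInf_X_cube_mul, ← pow_mul]
  · rw [← hfour, hasSum_cap2TermFour.tsum_eq,
      weightedSum_geomSeries_mul_tripleSeries (by simp) (by ring), ← qPochInf_X_mul, ← pow_mul,
      mul_comm (qPochInf (-X ^ 5) _)]
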